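/- **Setting.** An instance of *non-overfitting group identification* consists of a finite set of $n$ objects $O$, a finite set $C$ of classes, a class $c(o)\in C$ for each object, a probability distribution $p$ on $O$ with $p(o)>0$ for all $o$ (put $p(N)=\sum_{o\in N}p(o)$, $p_{\min}=\min_o p(o)$), a finite set $T$ of tests, where $t\in T$ returns a value $t(o)\in\{1,\dots,k_t\}$ and has a positive integer cost $w(t)$, and a threshold $\theta\in[0,1]$. A decision tree has a test at each internal node; a node is identified with the set $N\subseteq O$ of objects that reach it (the root is $O$), and its children under $t$ are $N_t^v=\{o\in N: t(o)=v\}$. Let $h(N)$ be the number of unordered pairs of objects of $N$ with distinct classes. A tree is *feasible* if each of its leaves $N$ satisfies $h(N)=0$ or $p(N)\le\theta$. Its *expected cost* is $\sum_o p(o)\,w(o)$, where $w(o)$ is the sum of the costs of the tests that $o$ goes through. **Impurity.** For a class distribution $q$ on $C$ let $\Phi(q)=\sum_c q_c\,\phi_c(q_c)$ with real functions $\phi_c$. Assume that $\Phi$ is a (decomposable) impurity function: on the simplex of class distributions it is nonnegative, zero at the pure distributions, maximal at the uniform distribution, concave, and symmetric. For a node $N$ put $\Phi_c(N)=\phi_c(p_c(N)/p(N))$,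 where $p_c(N)=\sum_{o\in N,\,c(o)=c}p(o)$, and $\Phi(N)=\sum_c\frac{p_c(N)}{p(N)}\Phi_c(N)$, $\Phi(N\mid t)=\sum_v\frac{p(N_t^v)}{p(N)}\Phi(N_t^v)$, and $\Phi_{\max}=\max_{N\subseteq O}\max_{o\in N}\Phi_{c(o)}(N)$. Let $\lambda\ge0$. **Algorithm.** For $i\in O$ and $S\subseteq T$ let $N_S^{(i)}=\{o\in O: t(o)=t(i)\text{ for all }t\in S\}$ and $$f_i(S)=1-\Bigl(1-\min\Bigl\{\tfrac{1-p(N_S^{(i)})}{1-\max\{p(i),\theta\}},1\Bigr\}\Bigr)\Bigl(1-\tfrac{h(O)-h(N_S^{(i)})}{h(O)}\Bigr).$$ The greedy tree-induction algorithm is recursive and starts at the root $O$ with $S=\emptyset$. At a node $N$, with $S$ the set of tests used so far, it returns a leaf labeled with a majority class of $N$ if all objects of $N$ have the same class or $p(N)\le\theta$. Otherwise it splits $N$ by a test $t\in T\setminus S$ that maximizes $$\frac1{w(t)}\Bigl(p(N)-p(N_t^{v^*})+\sum_{i\in N}p(i)\,\frac{f_i(S\cup\{t\})-f_i(S)}{f_i(T)-f_i(S)}+\lambda\,p(N)\bigl(\Phi(N)-\Phi(N\mid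 t)\bigr)\Bigr),$$ where $v^*$ is a value for which $|N_t^{v}|$ is largest, and recurses on every child $N_t^v$ with $S\cup\{t\}$. Ties are broken arbitrarily. **Theorem 1.** There is a universal constant $K>0$ such that, for every instance that has a feasible tree, every decomposable impurity function as above and every $\lambda\ge0$, the greedy tree-induction algorithm returns a tree, and every tree that it can return is feasible and has expected cost at most $$K\,\bigl(\log(1/p_{\min})+\log n+\lambda\,\Phi_{\max}\bigr)$$ times the expected cost of any feasible tree, hence of an optimal one. -/

import Mathlib

/-- A decision tree over tests `T`, where test `t` has the `arity t` possible values `Fin (arity t)`.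
An internal node carries a test and one subtree per test value; a leaf carries a class label. -/
inductive DTree (C T : Type) (arity : T → ℕ) : Type
  | leaf (c : C) : DTree C T arity
  | node (t : T) (child : Fin (arity t) → DTree C T arity) : DTree C T arity

/-- An instance of the non-overfitting group identification problem with finite sets of
objects `O`, class labels `C` and tests `T`. -/
structure NGI (O C T : Type) [Fintype O] where
  /-- number of possible values of a test -/
  arity : T → ℕ
  /-- value returned by a test on an object -/
  outcome : (t : T) → O → Fin (arity t)
  /-- class of an object -/
  cls : O → C
  /-- probability distribution over the objects -/
  prob : O → ℝ
  /-- (integral) cost of a test -/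
  cost : T → ℕ
  /-- threshold of the stopping condition -/
  thr : ℝ
  prob_pos : ∀ o, 0 < prob o
  prob_sum : ∑ o, prob o = 1
  cost_pos : ∀ t, 0 < cost t
  thr_nonneg : 0 ≤ thr
  thr_le_one : thr ≤ 1

/-- The function `q ↦ ∑ c, q c * φ c (q c)` of a class distribution `q`: the weighted sum of the
class scores `φ c (q c)`. -/
def decompImpurity {C : Type} [Fintype C] (φ : C → ℝ → ℝ) (q : C → ℝ) : ℝ :=
  ∑ c, q c * φ c (q c)

/-- The class scores `φ` define a (decomposable) impurity function on class distributions: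
nonnegative, zero at pure distributions, maximal at the uniform distribution, concave, symmetric. -/
structure IsDecomposableImpurity {C : Type} [Fintype C] [DecidableEq C] (φ : C → ℝ → ℝ) :
    Prop where
  nonneg : ∀ q ∈ stdSimplex ℝ C, 0 ≤ decompImpurity φ q
  pure_eq_zero : ∀ c : C, decompImpurity φ (Pi.single c 1) = 0
  le_uniform : ∀ q ∈ stdSimplex ℝ C,
    decompImpurity φ q ≤ decompImpurity φ (fun _ => 1 / (Fintype.card C : ℝ))
  concave : ConcaveOn ℝ (stdSimplex ℝ C) (decompImpurity φ)
  symmetric : ∀ (σ : Equiv.Perm C), ∀ q ∈ stdSimplex ℝ C,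
    decompImpurity φ (fun c => q (σ c)) = decompImpurity φ q

namespace NGI

noncomputable section

variable {O C T : Type} [Fintype O] [DecidableEq O] [Fintype C] [DecidableEq C]
  [Fintype T] [DecidableEq T]

/-- Probability of a node (a set of objects). -/
def P (I : NGI O C T) (N : Finset O) : ℝ := ∑ o ∈ N, I.prob o

/-- Total probability of the objects of class `c` in a node. -/
def Pc (I : NGI O C T) (c : C) (N : Finset O) : ℝ := ∑ o ∈ N with I.cls o = c, I.prob o

/-- The child of the node `N` under test `t` and test value `v`. -/
def child (I : NGI O C T) (N : Finset O) (t : T) (v : Fin (I.arity t)) : Finset O :=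
  N.filter (fun o => I.outcome t o = v)

/-- The node reached by object `i` from the root after the tests in `S`. -/
def reach (I : NGI O C T) (i : O) (S : Finset T) : Finset O :=
  Finset.univ.filter (fun o => ∀ t ∈ S, I.outcome t o = I.outcome t i)

/-- Number of heterogeneous (unordered) pairs of objects in a node. -/
def pairs (I : NGI O C T) (N : Finset O) : ℕ :=
  ((N.powersetCard 2).filter (fun s => ∃ a ∈ s, ∃ b ∈ s, I.cls a ≠ I.cls b)).card

/-- All objects of the node belong to the same class. -/
def Homogeneous (I : NGI O C T) (N : Finset O) : Prop :=
  ∀ a ∈ N, ∀ b ∈ N, I.cls a = I.cls b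

/-- Minimum object probability. -/
def pMin (I : NGI O C T) : ℝ := ⨅ o, I.prob o

/-! ### Decision trees: feasibility and cost -/

/-- Every leaf below the node `N` satisfies the leaf condition of the problem. -/
def FeasibleFrom (I : NGI O C T) : Finset O → DTree C T I.arity → Prop
  | N, .leaf _ => I.pairs N = 0 ∨ I.P N ≤ I.thr
  | N, .node t ch => ∀ v, FeasibleFrom I (I.child N t v) (ch v)

/-- The tree, rooted at the set of all objects, is a feasible solution. -/
def Feasible (I : NGI O C T) (τ : DTree C T I.arity) : Prop :=
  I.FeasibleFrom Finset.univ τ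

/-- Sum of the costs of all tests that the object goes through in the tree. -/
def treeCost (I : NGI O C T) : DTree C T I.arity → O → ℕ
  | .leaf _, _ => 0
  | .node t ch, o => I.cost t + treeCost I (ch (I.outcome t o)) o

/-- Expected cost of a tree. -/
def expectedCost (I : NGI O C T) (τ : DTree C T I.arity) : ℝ :=
  ∑ o, I.prob o * (I.treeCost τ o : ℝ)

/-! ### Impurity of nodes -/

/-- Class distribution of a node. -/
def classDist (I : NGI O C T) (N : Finset O) : C → ℝ := fun c => I.Pc c N / I.P N

/-- Impurity score of class `c` at a node. -/
def classScore (I : NGI O C T) (φ : C → ℝ → ℝ) (c : C) (N : Finset O) : ℝ :=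
  φ c (I.Pc c N / I.P N)

/-- Impurity of a node. -/
def impurity (I : NGI O C T) (φ : C → ℝ → ℝ) (N : Finset O) : ℝ :=
  decompImpurity φ (I.classDist N)

/-- Impurity of a node after it has been split by a test. -/
def condImpurity (I : NGI O C T) (φ : C → ℝ → ℝ) (N : Finset O) (t : T) : ℝ :=
  ∑ v, I.P (I.child N t v) / I.P N * I.impurity φ (I.child N t v)

/-- Largest impurity score, over all sets `N` of objects, of the class of an object of `N`. -/
def maxScore (I : NGI O C T) (φ : C → ℝ → ℝ) : ℝ :=
  sSup {x : ℝ | ∃ N : Finset O, ∃ o ∈ N, x = I.classScore φ (I.cls o) N}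

/-! ### The submodular functions and the greedy score -/

/-- Scaled probability of the objects excluded by the tests `S` for object `i`, truncated at 1. -/
def fProb (I : NGI O C T) (i : O) (S : Finset T) : ℝ :=
  min ((1 - I.P (I.reach i S)) / (1 - max (I.prob i) I.thr)) 1

/-- Scaled number of the heterogeneous pairs excluded by the tests `S` for object `i`. -/
def fPair (I : NGI O C T) (i : O) (S : Finset T) : ℝ :=
  ((I.pairs Finset.univ : ℝ) - (I.pairs (I.reach i S) : ℝ)) / (I.pairs Finset.univ : ℝ)

/-- Disjunction of the two functions. -/
def fOr (I : NGI O C T) (i : O) (S : Finset T) : ℝ :=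
  1 - (1 - I.fProb i S) * (1 - I.fPair i S)

/-- Balance of the split of `N` by `t`, when `v` is the value of the largest branch. -/
def balance (I : NGI O C T) (N : Finset O) (t : T) (v : Fin (I.arity t)) : ℝ :=
  I.P N - I.P (I.child N t v)

/-- Efficiency of the test `t` at the node `N` after the tests in `S`. -/
def efficiency (I : NGI O C T) (N : Finset O) (S : Finset T) (t : T) : ℝ :=
  ∑ i ∈ N, I.prob i *
    ((I.fOr i (insert t S) - I.fOr i S) / (I.fOr i Finset.univ - I.fOr i S))

/-- Discrimination of the test `t` at the node `N`. -/
def discrimination (I : NGI O C T) (φ : C → ℝ → ℝ) (N : Finset O) (t : T) : ℝ :=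
  I.P N * (I.impurity φ N - I.condImpurity φ N t)

/-- The greedy score of the test `t`, with trade-off parameter `lam`. -/
def score (I : NGI O C T) (φ : C → ℝ → ℝ) (lam : ℝ) (N : Finset O) (S : Finset T)
    (t : T) (v : Fin (I.arity t)) : ℝ :=
  1 / (I.cost t : ℝ) *
    (I.balance N t v + I.efficiency N S t + lam * I.discrimination φ N t)

/-- `c` is a majority class of the node `N`. -/
def IsMajority (I : NGI O C T) (N : Finset O) (c : C) : Prop :=
  ∀ c' : C, (N.filter (fun o => I.cls o = c')).card ≤ (N.filter (fun o => I.cls o = c)).card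

/-- `I.GreedyFrom φ lam N S τ`: the recursive greedy procedure, called at the node `N` with the
set `S` of tests used so far, can return the tree `τ` (all ties are broken arbitrarily).
In a split, `vmax e` is the value of a child of `N` of largest cardinality under the test `e`. -/
inductive GreedyFrom (I : NGI O C T) (φ : C → ℝ → ℝ) (lam : ℝ) :
    Finset O → Finset T → DTree C T I.arity → Prop
  | leaf (N : Finset O) (S : Finset T) (c : C)
      (hdone : I.Homogeneous N ∨ I.P N ≤ I.thr) (hc : I.IsMajority N c) :
      GreedyFrom I φ lam N S (.leaf c)
  | split (N : Finset O) (S : Finset T) (vmax : (e : T) → Fin (I.arity e)) (t : T)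
      (ch : Fin (I.arity t) → DTree C T I.arity)
      (hdone : ¬ (I.Homogeneous N ∨ I.P N ≤ I.thr))
      (hmax : ∀ e, ∀ v, (I.child N e v).card ≤ (I.child N e (vmax e)).card)
      (hnew : t ∉ S)
      (hgreedy : ∀ e, e ∉ S → I.score φ lam N S e (vmax e) ≤ I.score φ lam N S t (vmax t))
      (hrec : ∀ v, GreedyFrom I φ lam (I.child N t v) (insert t S) (ch v)) :
      GreedyFrom I φ lam N S (.node t ch)

/-- The greedy tree-induction algorithm can return the tree `τ`. -/
def IsGreedyTree (I : NGI O C T) (φ : C → ℝ → ℝ) (lam : ℝ) (τ : DTree C T I.arity) : Prop :=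
  I.GreedyFrom φ lam Finset.univ ∅ τ

end

end NGI

/-! The greedy tree is charged to an arbitrary feasible tree `τ'` by means of a potential. Let
greedy use a test of cost `w` and score `s` at the node `N`.

The score is large (`P_finished_le`): the objects of `N` that `τ'` finishes within cost `B` have
mass at most `s * B`. Follow `τ'` along the values of the largest children of `N`. Objects leaving
this path are counted by the balances of its tests. Objects staying to the end share a feasible
leaf, so the tests of the path have total relative gain at least one for each of them
(`one_le_sum_relGain`), and the efficiencies count them. Balance plus efficiency of a test is at
most `s` times its cost, because discrimination is nonnegative by concavity.

The scores cannot be large too often (`gain_add_pot_le`): `w * s` is at most the drop of `pot` from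
`N` to its children. The logarithm of `|N|` pays for the balance, logarithms of the excess
probability and of the pair count pay for the efficiency, and the impurity telescopes. Moreover
`pot` is at most `β = potBound` times the mass of the node.

`GreedyFrom.cost_le` combines both by induction on the greedy tree. Let `Y` be the greedy cost up to
and including the test at `N`. Objects that `τ'` has not finished within `Y / L` charge `w` to `L`
times their cost in `τ'`. The others have mass at most `s * Y / L`, and the potential weighted by
`Y` pays for them. The growth of this weight along the tree costs `β` times the greedy cost; `L = 2
* β` absorbs it and leaves the ratio `4 * β`. -/

namespace NGI

/-! ### The logarithmic potential -/

/-- Potential that pays for the relative decrements of a quantity whose absolute decrements are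
at least one. -/
noncomputable def logPot (a : ℝ) : ℝ := if a ≤ 0 then 0 else 1 + 2 * Real.log (1 + a)

theorem logPot_nonneg (a : ℝ) : 0 ≤ logPot a := by
  unfold logPot
  split_ifs with h
  · exact le_rfl
  · have := Real.log_nonneg (show (1 : ℝ) ≤ 1 + a by linarith)
    linarith

theorem logPot_le {a b : ℝ} (hb : 0 ≤ b) (hab : a ≤ b) : logPot a ≤ 1 + 2 * Real.log (1 + b) := by
  unfold logPot
  split_ifs with h
  · have := Real.log_nonneg (show (1 : ℝ) ≤ 1 + b by linarith)
    linarith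
  · have := Real.log_le_log (show (0 : ℝ) < 1 + a by linarith) (show 1 + a ≤ 1 + b by linarith)
    linarith

/-- A fall to a nonpositive value has relative decrement 1, paid by the jump of `logPot` at 0.
Otherwise a proper decrement forces `a ≥ 1 + a' > 1`, so `1 / a ≤ 2 / (1 + a)`, and `log x ≤ x - 1`
concludes. -/
theorem decrement_add_logPot_le {a a' : ℝ} (ha : 0 < a) (h : a' = a ∨ a' ≤ a - 1) :
    (1 - max a' 0 / a) + logPot a' ≤ logPot a := by
  rcases h with rfl | h
  · rw [max_eq_left ha.le, div_self ha.ne']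
    linarith
  · rcases le_or_gt a' 0 with h0 | h0
    · have := Real.log_nonneg (show (1 : ℝ) ≤ 1 + a by linarith)
      simp only [logPot, if_pos h0, if_neg (not_le.mpr ha), max_eq_right h0, zero_div]
      linarith
    · simp only [logPot, if_neg (not_le.mpr ha), if_neg (not_le.mpr h0), max_eq_left h0.le]
      have h1 : Real.log ((1 + a') / (1 + a)) ≤ (1 + a') / (1 + a) - 1 :=
        Real.log_le_sub_one_of_pos (by positivity)
      rw [Real.log_div (by positivity) (by positivity)] at h1
      have h2 : 1 - a' / a ≤ 2 * (1 - (1 + a') / (1 + a)) := by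
        have e1 : 1 - a' / a = (a - a') / a := by field_simp
        have e2 : 2 * (1 - (1 + a') / (1 + a)) = (2 * (a - a')) / (1 + a) := by field_simp; ring
        rw [e1, e2, div_le_div_iff₀ ha (by linarith)]
        nlinarith
      linarith

section

variable {O C T : Type} [Fintype O] (I : NGI O C T)

/-! ### Probabilities of nodes -/

theorem P_nonneg (N : Finset O) : 0 ≤ I.P N := Finset.sum_nonneg fun o _ => (I.prob_pos o).le

theorem P_mono {M N : Finset O} (h : M ⊆ N) : I.P M ≤ I.P N :=
  Finset.sum_le_sum_of_subset_of_nonneg h fun o _ _ => (I.prob_pos o).le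

theorem P_pos {N : Finset O} (h : N.Nonempty) : 0 < I.P N :=
  Finset.sum_pos (fun o _ => I.prob_pos o) h

theorem P_univ : I.P Finset.univ = 1 := I.prob_sum

theorem P_le_one (N : Finset O) : I.P N ≤ 1 := I.P_univ ▸ I.P_mono (Finset.subset_univ N)

include I in
theorem nonempty_objects : Nonempty O := by
  by_contra h
  rw [not_nonempty_iff] at h
  have := I.prob_sum
  simp at this

theorem pMin_le (o : O) : I.pMin ≤ I.prob o := ciInf_le (Set.finite_range _).bddBelow o

theorem pMin_pos : 0 < I.pMin := by
  have := I.nonempty_objects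
  obtain ⟨o, ho⟩ := exists_eq_ciInf_of_finite (f := I.prob)
  rw [pMin, ← ho]
  exact I.prob_pos o

theorem prob_le_P {N : Finset O} {o : O} (h : o ∈ N) : I.prob o ≤ I.P N :=
  Finset.single_le_sum (f := I.prob) (fun o _ => (I.prob_pos o).le) h

theorem pMin_le_one : I.pMin ≤ 1 := by
  obtain ⟨o⟩ := I.nonempty_objects
  exact (I.pMin_le o).trans ((I.prob_le_P (Finset.mem_univ o)).trans (I.P_le_one _))

theorem P_sub_P [DecidableEq O] {M N : Finset O} (h : M ⊆ N) : I.P N - I.P M = I.P (N \ M) := by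
  have := Finset.sum_sdiff (f := I.prob) h
  unfold P
  linarith

theorem P_biUnion_le {ι : Type*} [DecidableEq O] (Q : Finset ι) (A : ι → Finset O) :
    I.P (Q.biUnion A) ≤ ∑ t ∈ Q, I.P (A t) := by
  classical
  induction Q using Finset.induction_on with
  | empty => simp [P]
  | insert t Q ht ih =>
    rw [Finset.biUnion_insert, Finset.sum_insert ht]
    have h1 := Finset.sum_union_inter (f := I.prob) (s₁ := A t) (s₂ := Q.biUnion A)
    have h2 := I.P_nonneg (A t ∩ Q.biUnion A)
    unfold P at *
    linarith

theorem P_add_pMin_le [DecidableEq O] {M N : Finset O} (h : M ⊂ N) : I.P M + I.pMin ≤ I.P N := by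
  obtain ⟨o, ho⟩ := Finset.sdiff_nonempty.mpr h.2
  have h1 := I.prob_le_P ho
  rw [← I.P_sub_P h.1] at h1
  linarith [I.pMin_le o]

theorem mem_child {N : Finset O} {t : T} {v : Fin (I.arity t)} {o : O} :
    o ∈ I.child N t v ↔ o ∈ N ∧ I.outcome t o = v := by
  simp [child]

theorem child_subset (N : Finset O) (t : T) (v : Fin (I.arity t)) : I.child N t v ⊆ N :=
  Finset.filter_subset _ _

/-- Sums over a node split into sums over its children. -/
theorem sum_child (N : Finset O) (t : T) (g : O → ℝ) :
    ∑ v, ∑ o ∈ I.child N t v, g o = ∑ o ∈ N, g o :=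
  Finset.sum_fiberwise N (I.outcome t) g

theorem sum_P_child (N : Finset O) (t : T) : ∑ v, I.P (I.child N t v) = I.P N :=
  I.sum_child N t I.prob

variable [DecidableEq C]

/-! ### Heterogeneous pairs -/

theorem pairs_mono {M N : Finset O} (h : M ⊆ N) : I.pairs M ≤ I.pairs N :=
  Finset.card_le_card (Finset.filter_subset_filter _ (Finset.powersetCard_mono h))

theorem pairs_eq_zero_iff {N : Finset O} : I.pairs N = 0 ↔ I.Homogeneous N := by
  unfold pairs Homogeneous
  rw [Finset.card_eq_zero, Finset.filter_eq_empty_iff]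
  constructor
  · intro h a ha b hb
    by_contra hab
    have hne : a ≠ b := fun h => hab (h ▸ rfl)
    classical
    refine h (x := {a, b}) ?_ ⟨a, by simp, b, by simp, hab⟩
    rw [Finset.mem_powersetCard]
    exact ⟨by simp [Finset.insert_subset_iff, ha, hb], Finset.card_pair hne⟩
  · rintro h s hs ⟨a, ha, b, hb, hab⟩
    rw [Finset.mem_powersetCard] at hs
    exact hab (h a (hs.1 ha) b (hs.1 hb))

theorem pairs_le_sq (N : Finset O) : I.pairs N ≤ Fintype.card O ^ 2 := by
  refine (Finset.card_filter_le _ _).trans ?_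
  rw [Finset.card_powersetCard]
  exact (Nat.choose_le_pow _ _).trans (Nat.pow_le_pow_left (Finset.card_le_univ N) 2)

end

end NGI

/-! ### Unfinished nodes -/

namespace NGI

section

variable {O C T : Type} [Fintype O] [DecidableEq C] (I : NGI O C T)

/-- The two alternatives of the leaf condition of the algorithm fail. -/
def Unfinished (N : Finset O) : Prop := ¬ (I.Homogeneous N ∨ I.P N ≤ I.thr)

namespace Unfinished

variable {I} {N : Finset O}

theorem pairs_pos (h : I.Unfinished N) : 0 < I.pairs N :=
  Nat.pos_of_ne_zero fun h0 => h (Or.inl (I.pairs_eq_zero_iff.mp h0))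

omit [DecidableEq C] in
theorem thr_lt (h : I.Unfinished N) : I.thr < I.P N := not_le.mp fun h0 => h (Or.inr h0)

omit [DecidableEq C] in
theorem nonempty (h : I.Unfinished N) : N.Nonempty := by
  rw [Finset.nonempty_iff_ne_empty]
  rintro rfl
  exact h (Or.inl (by simp [Homogeneous]))

omit [DecidableEq C] in
-- An inhomogeneous node contains a second object, of positive probability. This keeps the
-- denominators of `relGain` positive.
theorem max_lt (h : I.Unfinished N) {i : O} (hi : i ∈ N) : max (I.prob i) I.thr < I.P N := by
  refine _root_.max_lt ?_ h.thr_lt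
  have : ∃ j ∈ N, j ≠ i := by
    by_contra! hj
    exact h (Or.inl fun a ha b hb => by rw [hj a ha, hj b hb])
  obtain ⟨j, hj, hji⟩ := this
  classical
  have h2 : ∑ o ∈ {i, j}, I.prob o ≤ I.P N :=
    I.P_mono (by simp [Finset.insert_subset_iff, hi, hj])
  rw [Finset.sum_pair hji.symm] at h2
  linarith [I.prob_pos j]

omit [DecidableEq C] in
theorem univ (h : I.Unfinished N) : I.Unfinished Finset.univ := by
  rintro (h1 | h1)
  · exact h (Or.inl fun a _ b _ => h1 a (Finset.mem_univ a) b (Finset.mem_univ b))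
  · exact h (Or.inr ((I.P_mono (Finset.subset_univ N)).trans h1))

end Unfinished

/-! ### Relative gains -/

/-- Relative gain of an object `i` when it moves from the node `N` to the node `N'`. -/
noncomputable def relGain (i : O) (N N' : Finset O) : ℝ :=
  1 - max (I.P N' - max (I.prob i) I.thr) 0 / (I.P N - max (I.prob i) I.thr) *
    ((I.pairs N' : ℝ) / I.pairs N)

section

variable {I} {N N' : Finset O} {i : O}

omit [DecidableEq C] in
theorem probRatio_nonneg (hN : I.Unfinished N) (hi : i ∈ N) :
    0 ≤ max (I.P N' - max (I.prob i) I.thr) 0 / (I.P N - max (I.prob i) I.thr) :=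
  div_nonneg (le_max_right _ _) (sub_nonneg.mpr (hN.max_lt hi).le)

omit [DecidableEq C] in
theorem probRatio_le_one (hN : I.Unfinished N) (hi : i ∈ N) (h : N' ⊆ N) :
    max (I.P N' - max (I.prob i) I.thr) 0 / (I.P N - max (I.prob i) I.thr) ≤ 1 := by
  have h1 := sub_pos.mpr (hN.max_lt hi)
  rw [div_le_one h1]
  exact max_le (by linarith [I.P_mono h]) h1.le

theorem pairRatio_nonneg : (0 : ℝ) ≤ (I.pairs N' : ℝ) / I.pairs N := by positivity

theorem pairRatio_le_one (h : N' ⊆ N) : (I.pairs N' : ℝ) / I.pairs N ≤ 1 :=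
  div_le_one_of_le₀ (by exact_mod_cast I.pairs_mono h) (by positivity)

/-- For ratios `a`, `b` in `[0, 1]`, the gain `1 - a * b` of a disjunction is at least `1 - a` and
`1 - b` and at most their sum. The lower bounds serve the comparison with a feasible tree, the upper
bound serves the potential. -/
theorem probRatio_le_relGain (hN : I.Unfinished N) (hi : i ∈ N) (h : N' ⊆ N) :
    1 - max (I.P N' - max (I.prob i) I.thr) 0 / (I.P N - max (I.prob i) I.thr) ≤
      I.relGain i N N' := by
  have := mul_le_of_le_one_right (probRatio_nonneg (N' := N') hN hi) (I.pairRatio_le_one h)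
  unfold relGain
  linarith

theorem pairRatio_le_relGain (hN : I.Unfinished N) (hi : i ∈ N) (h : N' ⊆ N) :
    1 - (I.pairs N' : ℝ) / I.pairs N ≤ I.relGain i N N' := by
  have := mul_le_of_le_one_left (I.pairRatio_nonneg (N := N) (N' := N')) (probRatio_le_one hN hi h)
  unfold relGain
  linarith

theorem relGain_nonneg (hN : I.Unfinished N) (hi : i ∈ N) (h : N' ⊆ N) : 0 ≤ I.relGain i N N' :=
  (sub_nonneg.mpr (probRatio_le_one hN hi h)).trans (probRatio_le_relGain hN hi h)

theorem relGain_le (hN : I.Unfinished N) (hi : i ∈ N) (h : N' ⊆ N) :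
    I.relGain i N N' ≤
      (1 - max (I.P N' - max (I.prob i) I.thr) 0 / (I.P N - max (I.prob i) I.thr)) +
        (1 - (I.pairs N' : ℝ) / I.pairs N) := by
  have := mul_nonneg (sub_nonneg.mpr (probRatio_le_one hN hi h))
    (sub_nonneg.mpr (I.pairRatio_le_one h))
  unfold relGain
  linarith

end

/-! ### Normalized marginal gains of `fOr` -/

variable [Fintype T] [DecidableEq T]

variable {I} in
-- The complement of a disjunction is a product. The truncation at 1 in `fProb` turns into a
-- positive part.
theorem one_sub_fOr {N : Finset O} {S : Finset T} {i : O} (h0 : I.Unfinished Finset.univ)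
    (h : I.reach i S = N) :
    1 - I.fOr i S = max (I.P N - max (I.prob i) I.thr) 0 / (1 - max (I.prob i) I.thr) *
      ((I.pairs N : ℝ) / I.pairs Finset.univ) := by
  have hm : 0 < 1 - max (I.prob i) I.thr := by
    have := h0.max_lt (Finset.mem_univ i)
    rw [P_univ] at this
    linarith
  have hp : (0 : ℝ) < I.pairs Finset.univ := by exact_mod_cast h0.pairs_pos
  have h1 : 1 - I.fProb i S =
      max (I.P N - max (I.prob i) I.thr) 0 / (1 - max (I.prob i) I.thr) := by
    rw [fProb, h, ← max_sub_sub_left, sub_self, ← max_div_div_right hm.le, zero_div]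
    congr 1
    field_simp
    ring
  have h2 : 1 - I.fPair i S = (I.pairs N : ℝ) / I.pairs Finset.univ := by
    rw [fPair, h]
    field_simp
    ring
  rw [← h1, ← h2, fOr]
  ring

/-- The tests separate the objects well enough for a feasible tree to exist. -/
def Separates : Prop :=
  ∀ i, I.pairs (I.reach i (Finset.univ : Finset T)) = 0 ∨
    I.P (I.reach i (Finset.univ : Finset T)) ≤ I.thr

variable {I} in
theorem fOr_univ (hT : I.Separates) (h0 : I.Unfinished Finset.univ) (i : O) :
    I.fOr i (Finset.univ : Finset T) = 1 := by
  have h := one_sub_fOr h0 (rfl : I.reach i (Finset.univ : Finset T) = _)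
  have : 1 - I.fOr i (Finset.univ : Finset T) = 0 := by
    rw [h]
    rcases hT i with h1 | h1
    · simp [h1]
    · rw [max_eq_right]
      · simp
      · linarith [le_max_right (I.prob i) I.thr]
  linarith

omit [DecidableEq C] in
theorem reach_insert (i : O) (S : Finset T) (t : T) :
    I.reach i (insert t S) = I.child (I.reach i S) t (I.outcome t i) := by
  ext o
  simp [reach, child, and_comm]

/-- Since `fOr` equals 1 once all tests are used, the normalizations at the root cancel in the
quotient of marginals. -/
theorem efficiency_eq (hT : I.Separates) {N : Finset O} {S : Finset T} (hN : I.Unfinished N)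
    (hr : ∀ i ∈ N, I.reach i S = N) (t : T) :
    I.efficiency N S t =
      ∑ i ∈ N, I.prob i * I.relGain i N (I.child N t (I.outcome t i)) := by
  refine Finset.sum_congr rfl fun i hi => ?_
  congr 1
  have h0 := hN.univ
  have e1 := one_sub_fOr h0 (hr i hi)
  have e2 := one_sub_fOr h0 ((I.reach_insert i S t).trans (by rw [hr i hi]))
  have hm := hN.max_lt hi
  have hm' := h0.max_lt (Finset.mem_univ i)
  rw [P_univ] at hm'
  have hp : (0 : ℝ) < I.pairs N := by exact_mod_cast hN.pairs_pos
  have hp' : (0 : ℝ) < I.pairs Finset.univ := by exact_mod_cast h0.pairs_pos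
  rw [max_eq_left (sub_pos.mpr hm).le] at e1
  have hd : I.P N - max (I.prob i) I.thr ≠ 0 := (sub_pos.mpr hm).ne'
  have hd' : 1 - max (I.prob i) I.thr ≠ 0 := (sub_pos.mpr hm').ne'
  rw [fOr_univ hT h0, e1, show I.fOr i (insert t S) - I.fOr i S =
    (1 - I.fOr i S) - (1 - I.fOr i (insert t S)) by ring, e1, e2, relGain]
  field_simp

/-! ### The potential of the efficiency -/

/-- Potential that pays for the efficiency of all tests below a node. -/
noncomputable def effPot (N : Finset O) : ℝ :=
  ∑ i ∈ N, I.prob i *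
    (logPot ((I.P N - max (I.prob i) I.thr) / I.pMin) + logPot (I.pairs N))

omit [Fintype T] [DecidableEq T] in
-- Losing an object lowers the probability by at least `pMin`, and the pair count is an integer.
-- Hence both scaled quantities have decrements that are zero or at least one, as
-- `decrement_add_logPot_le` requires.
theorem relGain_add_logPot_le {N N' : Finset O} (hN : I.Unfinished N) {i : O} (hi : i ∈ N)
    (h : N' ⊆ N) :
    I.relGain i N N' +
      (logPot ((I.P N' - max (I.prob i) I.thr) / I.pMin) + logPot (I.pairs N')) ≤
    logPot ((I.P N - max (I.prob i) I.thr) / I.pMin) + logPot (I.pairs N) := by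
  have hq := I.pMin_pos
  have hm := sub_pos.mpr (hN.max_lt hi)
  have h1 := decrement_add_logPot_le
    (a' := (I.P N' - max (I.prob i) I.thr) / I.pMin) (div_pos hm hq) (by
      rcases h.eq_or_ssubset with rfl | h'
      · exact Or.inl rfl
      · right
        rw [div_sub_one hq.ne']
        refine div_le_div_of_nonneg_right ?_ hq.le
        classical linarith [I.P_add_pMin_le h'])
  have h2 := decrement_add_logPot_le (a := (I.pairs N : ℝ)) (a' := (I.pairs N' : ℝ))
    (by exact_mod_cast hN.pairs_pos) (by
      rcases (I.pairs_mono h).eq_or_lt with h' | h'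
      · exact Or.inl (by rw [h'])
      · right
        rw [le_sub_iff_add_le]
        exact_mod_cast h')
  have h3 := I.relGain_le hN hi h
  rw [max_eq_left (by positivity : (0 : ℝ) ≤ I.pairs N')] at h2
  have e : max ((I.P N' - max (I.prob i) I.thr) / I.pMin) 0 /
      ((I.P N - max (I.prob i) I.thr) / I.pMin) =
      max (I.P N' - max (I.prob i) I.thr) 0 / (I.P N - max (I.prob i) I.thr) := by
    rw [← zero_div I.pMin, max_div_div_right hq.le, div_div_div_cancel_right₀ hq.ne']
    simp
  rw [e] at h1
  linarith

theorem efficiency_add_effPot_le (hT : I.Separates) {N : Finset O} {S : Finset T}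
    (hN : I.Unfinished N) (hr : ∀ i ∈ N, I.reach i S = N) (t : T) :
    I.efficiency N S t + ∑ v, I.effPot (I.child N t v) ≤ I.effPot N := by
  rw [I.efficiency_eq hT hN hr]
  have e : ∑ v, I.effPot (I.child N t v) = ∑ i ∈ N, I.prob i *
      (logPot ((I.P (I.child N t (I.outcome t i)) - max (I.prob i) I.thr) / I.pMin) +
        logPot (I.pairs (I.child N t (I.outcome t i)))) := by
    rw [← I.sum_child N t]
    refine Finset.sum_congr rfl fun v _ => Finset.sum_congr rfl fun i hi => ?_
    rw [(I.mem_child.mp hi).2]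
  rw [e, ← Finset.sum_add_distrib]
  refine Finset.sum_le_sum fun i hi => ?_
  rw [← mul_add]
  exact mul_le_mul_of_nonneg_left
    (I.relGain_add_logPot_le hN hi (I.child_subset N t _)) (I.prob_pos i).le

omit [Fintype T] [DecidableEq T] in
theorem effPot_le (N : Finset O) :
    I.effPot N ≤ I.P N * ((1 + 2 * Real.log (1 + 1 / I.pMin)) +
      (1 + 2 * Real.log (1 + (Fintype.card O : ℝ) ^ 2))) := by
  have hq := I.pMin_pos
  rw [effPot, show I.P N = ∑ o ∈ N, I.prob o from rfl, Finset.sum_mul]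
  change ∑ i ∈ N, I.prob i * (logPot ((I.P N - max (I.prob i) I.thr) / I.pMin) + _) ≤ _
  refine Finset.sum_le_sum fun i hi => mul_le_mul_of_nonneg_left ?_ (I.prob_pos i).le
  refine add_le_add (logPot_le (by positivity) ?_) (logPot_le (by positivity) ?_)
  · refine div_le_div_of_nonneg_right ?_ hq.le
    linarith [I.P_le_one N, le_max_right (I.prob i) I.thr, I.thr_nonneg]
  · exact_mod_cast I.pairs_le_sq N

omit [Fintype T] [DecidableEq T] in
theorem effPot_nonneg (N : Finset O) : 0 ≤ I.effPot N :=
  Finset.sum_nonneg fun i _ =>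
    mul_nonneg (I.prob_pos i).le (add_nonneg (logPot_nonneg _) (logPot_nonneg _))

/-! ### The potential of the balance -/

omit [DecidableEq C] [Fintype T] [DecidableEq T] in
theorem balance_nonneg (N : Finset O) (t : T) (v : Fin (I.arity t)) : 0 ≤ I.balance N t v :=
  sub_nonneg.mpr (I.P_mono (I.child_subset N t v))

omit [DecidableEq C] [Fintype T] [DecidableEq T] in
-- A child other than the largest has at most half of the objects, so its binary logarithm drops by
-- at least one, which pays for its mass. The balance is the total mass of these children.
theorem balance_add_le (N : Finset O) (t : T) (v₀ : Fin (I.arity t))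
    (hv : ∀ v, (I.child N t v).card ≤ (I.child N t v₀).card) :
    I.balance N t v₀ + ∑ v, I.P (I.child N t v) * Real.logb 2 (I.child N t v).card ≤
      I.P N * Real.logb 2 N.card := by
  have e : I.balance N t v₀ = ∑ v, if v = v₀ then 0 else I.P (I.child N t v) := by
    rw [balance, ← I.sum_P_child N t, ← Finset.sum_erase_eq_sub (Finset.mem_univ v₀),
      Finset.sum_ite, Finset.sum_const_zero, zero_add]
    refine Finset.sum_congr ?_ fun _ _ => rfl
    ext v
    simp
  rw [e, ← I.sum_P_child N t, Finset.sum_mul, ← Finset.sum_add_distrib]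
  refine Finset.sum_le_sum fun v _ => ?_
  rcases (I.child N t v).eq_empty_or_nonempty with h0 | h0
  · simp [h0, P]
  have hP := I.P_nonneg (I.child N t v)
  have hc : (0 : ℝ) < (I.child N t v).card := by exact_mod_cast h0.card_pos
  split_ifs with hvv
  · rw [zero_add]
    refine mul_le_mul_of_nonneg_left ?_ hP
    refine Real.logb_le_logb_of_le one_lt_two hc ?_
    exact_mod_cast Finset.card_le_card (I.child_subset N t v)
  · have h2 : 2 * (I.child N t v).card ≤ N.card := by
      classical
      have hd : Disjoint (I.child N t v) (I.child N t v₀) := by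
        rw [Finset.disjoint_left]
        intro o h1 h2
        rw [mem_child] at h1 h2
        exact hvv (h1.2.symm.trans h2.2)
      have h3 := Finset.card_le_card
        (Finset.union_subset (I.child_subset N t v) (I.child_subset N t v₀))
      rw [Finset.card_union_of_disjoint hd] at h3
      have := hv v
      omega
    have h3 : 1 + Real.logb 2 (I.child N t v).card ≤ Real.logb 2 N.card := by
      have h4 : Real.logb 2 (2 * (I.child N t v).card) ≤ Real.logb 2 N.card :=
        Real.logb_le_logb_of_le one_lt_two (by positivity) (by exact_mod_cast h2)
      rwa [Real.logb_mul two_ne_zero hc.ne', Real.logb_self_eq_one one_lt_two] at h4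
    nlinarith

end

end NGI

namespace NGI

section

variable {O C T : Type} [Fintype O] [DecidableEq C] (I : NGI O C T)

/-! ### Impurity -/

theorem Pc_nonneg (c : C) (N : Finset O) : 0 ≤ I.Pc c N :=
  Finset.sum_nonneg fun o _ => (I.prob_pos o).le

theorem bddAbove_classScore (φ : C → ℝ → ℝ) :
    BddAbove {x : ℝ | ∃ N : Finset O, ∃ o ∈ N, x = I.classScore φ (I.cls o) N} := by
  refine ((Set.finite_range fun z : Finset O × O =>
    I.classScore φ (I.cls z.2) z.1).subset ?_).bddAbove
  rintro x ⟨N, o, -, rfl⟩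
  exact ⟨(N, o), rfl⟩

theorem classScore_le_maxScore (φ : C → ℝ → ℝ) {N : Finset O} {o : O} (h : o ∈ N) :
    I.classScore φ (I.cls o) N ≤ I.maxScore φ :=
  le_csSup (I.bddAbove_classScore φ) ⟨N, o, h, rfl⟩

variable [Fintype C]

theorem sum_Pc (N : Finset O) : ∑ c, I.Pc c N = I.P N :=
  Finset.sum_fiberwise N I.cls I.prob

theorem classDist_mem {N : Finset O} (h : 0 < I.P N) : I.classDist N ∈ stdSimplex ℝ C := by
  refine ⟨fun c => div_nonneg (I.Pc_nonneg c N) h.le, ?_⟩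
  simp only [classDist]
  rw [← Finset.sum_div, I.sum_Pc, div_self h.ne']

/-- The impurity averages class scores, and classes absent from `N` have weight zero; their scores
need not be bounded. -/
theorem impurity_le_maxScore (φ : C → ℝ → ℝ) {N : Finset O} (h : 0 < I.P N) :
    I.impurity φ N ≤ I.maxScore φ := by
  have e : I.maxScore φ = ∑ c, I.classDist N c * I.maxScore φ := by
    rw [← Finset.sum_mul, (I.classDist_mem h).2, one_mul]
  rw [e, impurity, decompImpurity]
  refine Finset.sum_le_sum fun c _ => ?_
  by_cases hc : ∃ o ∈ N, I.cls o = c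
  · obtain ⟨o, ho, rfl⟩ := hc
    exact mul_le_mul_of_nonneg_left (I.classScore_le_maxScore φ ho) ((I.classDist_mem h).1 _)
  · push Not at hc
    have : I.Pc c N = 0 := by
      rw [Pc, Finset.filter_false_of_mem hc, Finset.sum_empty]
    simp [classDist, this]

theorem impurity_nonneg {φ : C → ℝ → ℝ} (hφ : IsDecomposableImpurity φ) {N : Finset O}
    (h : 0 < I.P N) : 0 ≤ I.impurity φ N :=
  hφ.nonneg _ (I.classDist_mem h)

theorem maxScore_nonneg {φ : C → ℝ → ℝ} (hφ : IsDecomposableImpurity φ) : 0 ≤ I.maxScore φ := by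
  have h : 0 < I.P Finset.univ := by rw [P_univ]; exact one_pos
  exact (I.impurity_nonneg hφ h).trans (I.impurity_le_maxScore φ h)

omit [Fintype C] in
theorem sum_Pc_child (N : Finset O) (t : T) (c : C) :
    ∑ v, I.Pc c (I.child N t v) = I.Pc c N := by
  simp only [Pc, Finset.sum_filter]
  exact I.sum_child N t _

/-- Jensen's inequality, applied only to children of positive mass: the class distribution of an
empty child is the zero vector, outside the simplex. -/
theorem condImpurity_le {φ : C → ℝ → ℝ} (hφ : IsDecomposableImpurity φ) {N : Finset O}
    (h : 0 < I.P N) (t : T) : I.condImpurity φ N t ≤ I.impurity φ N := by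
  classical
  set V : Finset (Fin (I.arity t)) := Finset.univ.filter fun v => 0 < I.P (I.child N t v) with hV
  have hz : ∀ v ∉ V, I.P (I.child N t v) = 0 := by
    intro v hv
    simp only [hV, Finset.mem_filter, Finset.mem_univ, true_and, not_lt] at hv
    exact le_antisymm hv (I.P_nonneg _)
  have hPc : ∀ v ∉ V, ∀ c, I.Pc c (I.child N t v) = 0 := by
    intro v hv
    have h1 := I.sum_Pc (I.child N t v)
    rw [hz v hv, Finset.sum_eq_zero_iff_of_nonneg fun c _ => I.Pc_nonneg c _] at h1
    exact fun c => h1 c (Finset.mem_univ c)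
  have hsum : ∑ v ∈ V, I.P (I.child N t v) / I.P N = 1 := by
    rw [Finset.sum_subset (Finset.subset_univ V) fun v _ hv => by rw [hz v hv, zero_div],
      ← Finset.sum_div, I.sum_P_child, div_self h.ne']
  have hj := hφ.concave.le_map_sum (t := V) (w := fun v => I.P (I.child N t v) / I.P N)
    (p := fun v => I.classDist (I.child N t v))
    (fun v _ => div_nonneg (I.P_nonneg _) h.le) hsum
    (fun v hv => I.classDist_mem (Finset.mem_filter.mp hv).2)
  have hm : ∑ v ∈ V, (I.P (I.child N t v) / I.P N) • I.classDist (I.child N t v) =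
      I.classDist N := by
    ext c
    rw [Finset.sum_apply]
    simp only [classDist, Pi.smul_apply, smul_eq_mul]
    rw [← I.sum_Pc_child N t c, Finset.sum_div,
      ← Finset.sum_subset (Finset.subset_univ V) fun v _ hv => by rw [hPc v hv, zero_div]]
    refine Finset.sum_congr rfl fun v hv => ?_
    have := (Finset.mem_filter.mp hv).2
    field_simp
  rw [hm] at hj
  refine le_of_eq_of_le ?_ hj
  rw [condImpurity, ← Finset.sum_subset (Finset.subset_univ V) fun v _ hv => by
    rw [hz v hv, zero_div, zero_mul]]
  simp only [smul_eq_mul, impurity]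

theorem discrimination_nonneg {φ : C → ℝ → ℝ} (hφ : IsDecomposableImpurity φ) {N : Finset O}
    (h : 0 < I.P N) (t : T) : 0 ≤ I.discrimination φ N t :=
  mul_nonneg h.le (sub_nonneg.mpr (I.condImpurity_le hφ h t))

theorem discrimination_add (φ : C → ℝ → ℝ) {N : Finset O} (h : 0 < I.P N) (t : T) :
    I.discrimination φ N t + ∑ v, I.P (I.child N t v) * I.impurity φ (I.child N t v) =
      I.P N * I.impurity φ N := by
  have : I.P N * I.condImpurity φ N t =
      ∑ v, I.P (I.child N t v) * I.impurity φ (I.child N t v) := by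
    rw [condImpurity, Finset.mul_sum]
    refine Finset.sum_congr rfl fun v _ => ?_
    field_simp
  rw [discrimination, mul_sub, this]
  ring

/-! ### The potential of the greedy score -/

/-- Potential that pays for the gains of all tests below a node. -/
noncomputable def pot (φ : C → ℝ → ℝ) (lam : ℝ) (N : Finset O) : ℝ :=
  I.P N * Real.logb 2 N.card + I.effPot N + lam * (I.P N * I.impurity φ N)

/-- Bound of the potential relative to the probability of the node. -/
noncomputable def potBound (φ : C → ℝ → ℝ) (lam : ℝ) : ℝ :=
  Real.logb 2 (Fintype.card O) + ((1 + 2 * Real.log (1 + 1 / I.pMin)) +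
    (1 + 2 * Real.log (1 + (Fintype.card O : ℝ) ^ 2))) + lam * I.maxScore φ

variable {φ : C → ℝ → ℝ} {lam : ℝ}

theorem pot_nonneg (hφ : IsDecomposableImpurity φ) (hl : 0 ≤ lam) (N : Finset O) :
    0 ≤ I.pot φ lam N := by
  rcases N.eq_empty_or_nonempty with rfl | h
  · simp [pot, effPot, P]
  · have h1 := I.P_pos h
    have h2 := I.impurity_nonneg hφ h1
    have h3 := I.effPot_nonneg N
    have h4 : 0 ≤ Real.logb 2 N.card :=
      Real.logb_nonneg one_lt_two (by exact_mod_cast h.card_pos)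
    unfold pot
    positivity

theorem pot_le (hl : 0 ≤ lam) {N : Finset O} (h : N.Nonempty) :
    I.pot φ lam N ≤ I.P N * I.potBound φ lam := by
  have h1 := I.P_pos h
  have h2 := I.effPot_le N
  have h3 : Real.logb 2 N.card ≤ Real.logb 2 (Fintype.card O) :=
    Real.logb_le_logb_of_le one_lt_two (by exact_mod_cast h.card_pos)
      (by exact_mod_cast Finset.card_le_univ N)
  have h4 := mul_le_mul_of_nonneg_left h3 h1.le
  have h5 := mul_le_mul_of_nonneg_left
    (mul_le_mul_of_nonneg_left (I.impurity_le_maxScore φ h1) h1.le) hl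
  unfold pot potBound
  linarith

variable [Fintype T] [DecidableEq T]

/-- Cost-free part of the greedy score. -/
noncomputable def gain (φ : C → ℝ → ℝ) (lam : ℝ) (N : Finset O) (S : Finset T) (t : T)
    (v : Fin (I.arity t)) : ℝ :=
  I.balance N t v + I.efficiency N S t + lam * I.discrimination φ N t

theorem gain_eq (N : Finset O) (S : Finset T) (t : T) (v : Fin (I.arity t)) :
    I.gain φ lam N S t v = I.cost t * I.score φ lam N S t v := by
  have : (0 : ℝ) < I.cost t := by exact_mod_cast I.cost_pos t
  unfold gain score
  field_simp

theorem gain_add_pot_le (hT : I.Separates) {N : Finset O} {S : Finset T}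
    (hN : I.Unfinished N) (hr : ∀ i ∈ N, I.reach i S = N) (t : T) (v₀ : Fin (I.arity t))
    (hv : ∀ v, (I.child N t v).card ≤ (I.child N t v₀).card) :
    I.gain φ lam N S t v₀ + ∑ v, I.pot φ lam (I.child N t v) ≤ I.pot φ lam N := by
  have h1 := I.balance_add_le N t v₀ hv
  have h2 := I.efficiency_add_effPot_le hT hN hr t
  have h3 := I.discrimination_add φ (I.P_pos hN.nonempty) t
  simp only [pot, Finset.sum_add_distrib, ← Finset.mul_sum, ← h3, gain]
  linarith

/-! ### The lower bound of the greedy score -/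

omit [Fintype C] in
theorem efficiency_nonneg (hT : I.Separates) {N : Finset O} {S : Finset T}
    (hN : I.Unfinished N) (hr : ∀ i ∈ N, I.reach i S = N) (t : T) : 0 ≤ I.efficiency N S t := by
  rw [I.efficiency_eq hT hN hr]
  exact Finset.sum_nonneg fun i hi =>
    mul_nonneg (I.prob_pos i).le (relGain_nonneg hN hi (I.child_subset _ _ _))

omit [Fintype C] in
/-- Tests that bring an object into a feasible leaf have total relative gain at least one. -/
theorem one_le_sum_relGain {N : Finset O} (hN : I.Unfinished N) {i : O} (hi : i ∈ N)
    (Q : Finset T) (hQ : I.pairs (N.filter fun o => ∀ t ∈ Q, I.outcome t o = I.outcome t i) = 0 ∨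
      I.P (N.filter fun o => ∀ t ∈ Q, I.outcome t o = I.outcome t i) ≤ I.thr) :
    1 ≤ ∑ t ∈ Q, I.relGain i N (I.child N t (I.outcome t i)) := by
  classical
  set M := N.filter fun o => ∀ t ∈ Q, I.outcome t o = I.outcome t i with hM
  have hsub : ∀ t, I.child N t (I.outcome t i) ⊆ N := fun t => I.child_subset N t _
  have hnn : ∀ t ∈ Q, 0 ≤ I.relGain i N (I.child N t (I.outcome t i)) :=
    fun t _ => relGain_nonneg hN hi (hsub t)
  rcases hQ with hQ | hQ
  · have hp : (0 : ℝ) < I.pairs N := by exact_mod_cast hN.pairs_pos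
    refine le_trans ?_ (Finset.sum_le_sum fun t _ => pairRatio_le_relGain hN hi (hsub t))
    have hrw : ∀ t ∈ Q, 1 - (I.pairs (I.child N t (I.outcome t i)) : ℝ) / I.pairs N =
        ((I.pairs N : ℝ) - I.pairs (I.child N t (I.outcome t i))) / I.pairs N := by
      intro t _
      field_simp
    rw [Finset.sum_congr rfl hrw, ← Finset.sum_div, le_div_iff₀ hp, one_mul]
    let H : Finset O → Finset (Finset O) := fun A =>
      (A.powersetCard 2).filter (fun s => ∃ a ∈ s, ∃ b ∈ s, I.cls a ≠ I.cls b)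
    have hHcard : ∀ A, I.pairs A = (H A).card := fun _ => rfl
    have hHsub : ∀ t, H (I.child N t (I.outcome t i)) ⊆ H N := fun t =>
      Finset.filter_subset_filter _ (Finset.powersetCard_mono (hsub t))
    -- A heterogeneous pair that no test of `Q` removes would lie in `M`, which has none.
    have hcov : H N ⊆ Q.biUnion fun t => H N \ H (I.child N t (I.outcome t i)) := by
      intro s hs
      by_contra hcon
      simp only [Finset.mem_biUnion, Finset.mem_sdiff, not_exists, not_and, not_not] at hcon
      have hs' := hs
      simp only [H, Finset.mem_filter, Finset.mem_powersetCard] at hs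
      have hsM : s ∈ H M := by
        simp only [H, Finset.mem_filter, Finset.mem_powersetCard]
        refine ⟨⟨fun o ho => ?_, hs.1.2⟩, hs.2⟩
        rw [hM, Finset.mem_filter]
        refine ⟨hs.1.1 ho, fun t ht => ?_⟩
        have := hcon t ht hs'
        simp only [H, Finset.mem_filter, Finset.mem_powersetCard] at this
        exact (I.mem_child.mp (this.1.1 ho)).2
      rw [hHcard, Finset.card_eq_zero] at hQ
      rw [hQ] at hsM
      simp at hsM
    have hc := (Finset.card_le_card hcov).trans Finset.card_biUnion_le
    have hc' : ((H N).card : ℝ) ≤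
        ∑ t ∈ Q, ((H N \ H (I.child N t (I.outcome t i))).card : ℝ) := by exact_mod_cast hc
    rw [hHcard N]
    refine hc'.trans (Finset.sum_le_sum fun t _ => le_of_eq ?_)
    rw [Finset.card_sdiff_of_subset (hHsub t), Nat.cast_sub (Finset.card_le_card (hHsub t)),
      hHcard]
  · set m := max (I.prob i) I.thr with hm
    have hd : 0 < I.P N - m := sub_pos.mpr (hN.max_lt hi)
    -- A child of mass at most `m` has relative gain 1 on its own. If there is none, no truncation
    -- is active and the union bound applies.
    by_cases hex : ∃ t ∈ Q, I.P (I.child N t (I.outcome t i)) ≤ m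
    · obtain ⟨t, ht, hle⟩ := hex
      refine le_trans ?_ (Finset.single_le_sum hnn ht)
      refine le_trans (le_of_eq ?_) (probRatio_le_relGain hN hi (hsub t))
      rw [max_eq_right (by linarith), zero_div, sub_zero]
    · push Not at hex
      refine le_trans ?_ (Finset.sum_le_sum fun t _ => probRatio_le_relGain hN hi (hsub t))
      have hrw : ∀ t ∈ Q, 1 - max (I.P (I.child N t (I.outcome t i)) - m) 0 / (I.P N - m) =
          I.P (N \ I.child N t (I.outcome t i)) / (I.P N - m) := by
        intro t ht
        rw [max_eq_left (by linarith [hex t ht]), ← I.P_sub_P (hsub t)]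
        field_simp
        ring
      rw [Finset.sum_congr rfl hrw, ← Finset.sum_div, le_div_iff₀ hd, one_mul]
      have hcov : N \ M ⊆ Q.biUnion fun t => N \ I.child N t (I.outcome t i) := by
        intro o ho
        rw [Finset.mem_sdiff, hM, Finset.mem_filter] at ho
        simp only [Finset.mem_biUnion, Finset.mem_sdiff, mem_child]
        by_contra! hcon
        exact ho.2 ⟨ho.1, fun t ht => (hcon t ht ho.1).2⟩
      have h1 := I.P_mono hcov
      have h2 : I.P (Q.biUnion fun t => N \ I.child N t (I.outcome t i)) ≤
          ∑ t ∈ Q, I.P (N \ I.child N t (I.outcome t i)) :=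
        I.P_biUnion_le _ _
      rw [← I.P_sub_P (Finset.filter_subset _ N)] at h1
      have h3 : I.thr ≤ m := le_max_right _ _
      linarith

omit [Fintype C] in
/-- If every test has balance plus efficiency at most `s` times its cost at the node `N`, then any
tree finishes the objects of `N` at a rate at most `s`. -/
theorem P_finished_le [DecidableEq O] (hT : I.Separates) {N : Finset O} {S : Finset T}
    (hN : I.Unfinished N) (hr : ∀ i ∈ N, I.reach i S = N) (vm : (e : T) → Fin (I.arity e))
    {s : ℝ} (hs0 : 0 ≤ s)
    (hs : ∀ e, I.balance N e (vm e) + I.efficiency N S e ≤ I.cost e * s)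
    (τ : DTree C T I.arity) : ∀ (M : Finset O) (Q : Finset T), I.FeasibleFrom M τ →
      (∀ o, o ∈ M ↔ ∀ t ∈ Q, I.outcome t o = vm t) → ∀ B : ℝ, 0 ≤ B →
      I.P (N.filter fun o => o ∈ M ∧ (I.treeCost τ o : ℝ) ≤ B) ≤
        s * B + ∑ t ∈ Q, I.efficiency N S t := by
  classical
  have heff := I.efficiency_nonneg hT hN hr
  induction τ with
  | leaf c =>
    intro M Q hf hM B hB
    -- After exchanging the sums, each object of the leaf contributes at least its probability, and
    -- the other objects of `N` contribute nonnegatively.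
    have h1 : I.P (N.filter fun o => o ∈ M) ≤ ∑ t ∈ Q, I.efficiency N S t := by
      simp only [I.efficiency_eq hT hN hr]
      rw [Finset.sum_comm]
      simp only [← Finset.mul_sum]
      refine le_trans (Finset.sum_le_sum (g := fun i => I.prob i *
        ∑ t ∈ Q, I.relGain i N (I.child N t (I.outcome t i))) fun i hi => ?_)
        (Finset.sum_le_sum_of_subset_of_nonneg (Finset.filter_subset _ N) fun i hi _ =>
          mul_nonneg (I.prob_pos i).le (Finset.sum_nonneg fun t _ =>
            relGain_nonneg hN hi (I.child_subset _ _ _)))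
      rw [Finset.mem_filter] at hi
      refine le_mul_of_one_le_right (I.prob_pos i).le (I.one_le_sum_relGain hN hi.1 Q ?_)
      have hiM := (hM i).mp hi.2
      have hsub : (N.filter fun o => ∀ t ∈ Q, I.outcome t o = I.outcome t i) ⊆ M := by
        intro o ho
        rw [Finset.mem_filter] at ho
        exact (hM o).mpr fun t ht => (ho.2 t ht).trans (hiM t ht)
      exact Or.imp (fun h => Nat.le_zero.mp ((I.pairs_mono hsub).trans_eq h)) (I.P_mono hsub).trans hf
    have h2 : I.P (N.filter fun o => o ∈ M ∧ (I.treeCost (.leaf c) o : ℝ) ≤ B) ≤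
        I.P (N.filter fun o => o ∈ M) :=
      I.P_mono (Finset.monotone_filter_right N fun o _ h => h.1)
    have := mul_nonneg hs0 hB
    linarith
  | node t ch ih =>
    intro M Q hf hM B hB
    have hQ0 : 0 ≤ ∑ t ∈ Q, I.efficiency N S t := Finset.sum_nonneg fun t _ => heff t
    rcases lt_or_ge B (I.cost t : ℝ) with hB' | hB'
    · rw [Finset.filter_false_of_mem]
      · have := mul_nonneg hs0 hB
        simp only [P, Finset.sum_empty]
        linarith
      · rintro o - ⟨-, ho⟩
        simp only [treeCost, Nat.cast_add] at ho
        have : (0 : ℝ) ≤ I.treeCost (ch (I.outcome t o)) o := by positivity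
        linarith
    · have h1 := ih (vm t) (I.child M t (vm t)) (insert t Q) (hf (vm t)) (by
        intro o
        rw [mem_child, hM o, Finset.forall_mem_insert, and_comm]) (B - I.cost t) (by linarith)
      -- A test repeated on the path enters `Q` only once, hence an inequality.
      have h2 : ∑ t ∈ insert t Q, I.efficiency N S t ≤
          I.efficiency N S t + ∑ t ∈ Q, I.efficiency N S t := by
        by_cases ht : t ∈ Q
        · rw [Finset.insert_eq_of_mem ht]
          linarith [heff t]
        · rw [Finset.sum_insert ht]
      -- Objects finished within `B` either leave the followed branch, with mass at most the
      -- balance, or are finished below it with the remaining budget.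
      have h3 : (N.filter fun o => o ∈ M ∧ (I.treeCost (.node t ch) o : ℝ) ≤ B) ⊆
          (N \ I.child N t (vm t)) ∪ (N.filter fun o => o ∈ I.child M t (vm t) ∧
            (I.treeCost (ch (vm t)) o : ℝ) ≤ B - I.cost t) := by
        intro o ho
        rw [Finset.mem_filter] at ho
        by_cases hv : I.outcome t o = vm t
        · refine Finset.mem_union_right _ (Finset.mem_filter.mpr
            ⟨ho.1, I.mem_child.mpr ⟨ho.2.1, hv⟩, ?_⟩)
          have := ho.2.2
          simp only [treeCost, Nat.cast_add, hv] at this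
          linarith
        · refine Finset.mem_union_left _ (Finset.mem_sdiff.mpr ⟨ho.1, fun h => hv ?_⟩)
          exact (I.mem_child.mp h).2
      have h4 := I.P_mono h3
      have h5 := Finset.sum_union_inter (f := I.prob) (s₁ := N \ I.child N t (vm t))
        (s₂ := N.filter fun o => o ∈ I.child M t (vm t) ∧
            (I.treeCost (ch (vm t)) o : ℝ) ≤ B - I.cost t)
      have h6 := I.P_nonneg ((N \ I.child N t (vm t)) ∩
        (N.filter fun o => o ∈ I.child M t (vm t) ∧
            (I.treeCost (ch (vm t)) o : ℝ) ≤ B - I.cost t))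
      have h7 := hs t
      rw [balance, I.P_sub_P (I.child_subset _ _ _)] at h7
      simp only [P] at h1 h4 h6 h7 ⊢
      linarith

end

end NGI

/-! ### Charging the greedy cost to a feasible tree -/

namespace NGI

section

variable {O C T : Type} [Fintype O] [DecidableEq O] [Fintype C] [DecidableEq C]
  [Fintype T] [DecidableEq T] (I : NGI O C T) {φ : C → ℝ → ℝ} {lam : ℝ}

omit [DecidableEq O] [Fintype C] in
/-- At a node reached by the tests in `S`, the tests in `S` have neither balance nor efficiency. -/
theorem balance_add_efficiency_of_mem {N : Finset O} {S : Finset T} (hN : N.Nonempty)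
    (hr : ∀ i ∈ N, I.reach i S = N) {e : T} (he : e ∈ S) {v₀ : Fin (I.arity e)}
    (hv : ∀ v, (I.child N e v).card ≤ (I.child N e v₀).card) :
    I.balance N e v₀ + I.efficiency N S e = 0 := by
  obtain ⟨i, hi⟩ := hN
  have hchild : I.child N e (I.outcome e i) = N := by
    refine Finset.filter_true_of_mem fun o ho => ?_
    rw [← hr i hi, reach, Finset.mem_filter] at ho
    exact ho.2 e he
  have hcard := hv (I.outcome e i)
  rw [hchild] at hcard
  have h0 : I.child N e v₀ = N := Finset.eq_of_subset_of_card_le (I.child_subset N e v₀) hcard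
  simp [balance, efficiency, h0, Finset.insert_eq_of_mem he]

/-- The greedy score bounds the rate at which any feasible tree finishes the objects of a node. -/
theorem P_finished_le_score_mul (hT : I.Separates) (hφ : IsDecomposableImpurity φ)
    (hl : 0 ≤ lam) {N : Finset O} {S : Finset T} (hN : I.Unfinished N)
    (hr : ∀ i ∈ N, I.reach i S = N) (vmax : (e : T) → Fin (I.arity e)) {t : T}
    (hmax : ∀ e, ∀ v, (I.child N e v).card ≤ (I.child N e (vmax e)).card)
    (hgreedy : ∀ e, e ∉ S → I.score φ lam N S e (vmax e) ≤ I.score φ lam N S t (vmax t))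
    (τ' : DTree C T I.arity) (hf : I.Feasible τ') {B : ℝ} (hB : 0 ≤ B) :
    I.P (N.filter fun o => (I.treeCost τ' o : ℝ) ≤ B) ≤ I.score φ lam N S t (vmax t) * B := by
  have hdisc : ∀ e, 0 ≤ lam * I.discrimination φ N e := fun e =>
    mul_nonneg hl (I.discrimination_nonneg hφ (I.P_pos hN.nonempty) e)
  have hcost : ∀ e, (0 : ℝ) < I.cost e := fun e => by exact_mod_cast I.cost_pos e
  have hs0 : 0 ≤ I.score φ lam N S t (vmax t) := by
    have h1 := I.gain_eq (φ := φ) (lam := lam) N S t (vmax t)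
    have h2 : 0 ≤ I.gain φ lam N S t (vmax t) :=
      add_nonneg (add_nonneg (I.balance_nonneg _ _ _) (I.efficiency_nonneg hT hN hr t)) (hdisc t)
    rw [h1] at h2
    exact nonneg_of_mul_nonneg_right h2 (hcost t)
  have := I.P_finished_le hT hN hr vmax hs0 (fun e => by
    -- Greedy maximizes only over tests outside `S`, whereas `τ'` may use any test; those in `S`
    -- contribute zero.
    by_cases he : e ∈ S
    · rw [I.balance_add_efficiency_of_mem hN.nonempty hr he (hmax e)]
      exact mul_nonneg (hcost e).le hs0
    · refine le_trans ?_ (mul_le_mul_of_nonneg_left (hgreedy e he) (hcost e).le)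
      rw [← I.gain_eq, gain]
      linarith [hdisc e]) τ' Finset.univ ∅ hf (by simp) B hB
  simpa using this

omit [DecidableEq O] [Fintype C] [DecidableEq C] [Fintype T] [DecidableEq T] in
/-- The cost of the test at a node splits off the cost of the tree. -/
theorem sum_treeCost_node (N : Finset O) (t : T) (ch : Fin (I.arity t) → DTree C T I.arity) :
    ∑ o ∈ N, I.prob o * (I.treeCost (.node t ch) o : ℝ) =
      I.cost t * I.P N +
        ∑ v, ∑ o ∈ I.child N t v, I.prob o * (I.treeCost (ch v) o : ℝ) := by
  have e : ∑ v, ∑ o ∈ I.child N t v, I.prob o * (I.treeCost (ch v) o : ℝ) =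
      ∑ o ∈ N, I.prob o * (I.treeCost (ch (I.outcome t o)) o : ℝ) := by
    rw [← I.sum_child N t]
    refine Finset.sum_congr rfl fun v _ => Finset.sum_congr rfl fun i hi => ?_
    rw [(I.mem_child.mp hi).2]
  rw [e, P, Finset.mul_sum, ← Finset.sum_add_distrib]
  refine Finset.sum_congr rfl fun o _ => ?_
  simp only [treeCost, Nat.cast_add]
  ring

omit [DecidableEq O] [Fintype C] [DecidableEq C] in
theorem reach_child {N : Finset O} {S : Finset T} (hr : ∀ i ∈ N, I.reach i S = N) (t : T)
    (v : Fin (I.arity t)) : ∀ i ∈ I.child N t v, I.reach i (insert t S) = I.child N t v := by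
  intro i hi
  rw [mem_child] at hi
  rw [I.reach_insert, hr i hi.1, hi.2]

/-- Cost of a greedy subtree whose root is entered after tests of total cost `y`. -/
theorem GreedyFrom.cost_le (hT : I.Separates) (hφ : IsDecomposableImpurity φ) (hl : 0 ≤ lam)
    {τ' : DTree C T I.arity} (hf : I.Feasible τ') {L : ℝ} (hL : 0 < L)
    {N : Finset O} {S : Finset T} {τ : DTree C T I.arity} (h : I.GreedyFrom φ lam N S τ) :
    (∀ i ∈ N, I.reach i S = N) → ∀ y : ℝ, 0 ≤ y →
      L * ∑ o ∈ N, I.prob o * (I.treeCost τ o : ℝ) ≤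
        y * I.pot φ lam N + I.potBound φ lam * ∑ o ∈ N, I.prob o * (I.treeCost τ o : ℝ) +
          L * ∑ o ∈ N, I.prob o * max (L * I.treeCost τ' o - y) 0 := by
  induction h with
  | leaf N S c hdone hc =>
    intro hr y hy
    have h1 := mul_nonneg hy (I.pot_nonneg hφ hl N)
    have h2 : 0 ≤ ∑ o ∈ N, I.prob o * max (L * I.treeCost τ' o - y) 0 :=
      Finset.sum_nonneg fun o _ => mul_nonneg (I.prob_pos o).le (le_max_right _ _)
    simp only [treeCost, Nat.cast_zero, mul_zero, Finset.sum_const_zero, add_zero]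
    positivity
  | split N S vmax t ch hdone hmax hnew hgreedy hrec ih =>
    intro hr y hy
    have hN : I.Unfinished N := hdone
    have hw : (0 : ℝ) < I.cost t := by exact_mod_cast I.cost_pos t
    set w : ℝ := (I.cost t : ℝ) with hwdef
    set Y := y + w with hY
    have hY0 : 0 ≤ Y := by positivity
    set s := I.score φ lam N S t (vmax t) with hs
    have hgain := I.gain_add_pot_le (φ := φ) (lam := lam) hT hN hr t (vmax t) (hmax t)
    rw [gain_eq, ← hs, ← hwdef] at hgain
    have hpot := I.pot_le (φ := φ) (lam := lam) hl hN.nonempty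
    have hrate := I.P_finished_le_score_mul hT hφ hl hN hr vmax hmax hgreedy τ' hf
      (B := Y / L) (by positivity)
    rw [← hs] at hrate
    have hsplit : I.P N = I.P (N.filter fun o => (I.treeCost τ' o : ℝ) ≤ Y / L) +
        I.P (N.filter fun o => ¬ (I.treeCost τ' o : ℝ) ≤ Y / L) :=
      (Finset.sum_filter_add_sum_filter_not N _ _).symm
    -- For an object unfinished at `Y / L`, both positive parts are active and differ by exactly
    -- `w`.
    have hfin : w * I.P (N.filter fun o => ¬ (I.treeCost τ' o : ℝ) ≤ Y / L) +
        ∑ v, ∑ o ∈ I.child N t v, I.prob o * max (L * I.treeCost τ' o - Y) 0 ≤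
        ∑ o ∈ N, I.prob o * max (L * I.treeCost τ' o - y) 0 := by
      rw [I.sum_child N t, P, Finset.sum_filter, Finset.mul_sum, ← Finset.sum_add_distrib]
      refine Finset.sum_le_sum fun o _ => ?_
      have hp := I.prob_pos o
      rcases le_or_gt (I.treeCost τ' o : ℝ) (Y / L) with h1 | h1
      · rw [if_neg (not_not.mpr h1)]
        rw [le_div_iff₀ hL] at h1
        rw [max_eq_right (by linarith)]
        simpa using mul_nonneg hp.le (le_max_right (L * (I.treeCost τ' o : ℝ) - y) 0)
      · rw [if_pos (not_le.mpr h1)]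
        rw [div_lt_iff₀ hL] at h1
        rw [max_eq_left (by linarith), max_eq_left (by linarith)]
        exact le_of_eq (by rw [hY]; ring)
    have hsum := Finset.sum_le_sum fun v (_ : v ∈ Finset.univ) =>
      ih v (I.reach_child hr t v) Y hY0
    simp only [Finset.sum_add_distrib, ← Finset.mul_sum] at hsum
    rw [I.sum_treeCost_node, ← hwdef]
    set X := ∑ v, ∑ o ∈ I.child N t v, I.prob o * (I.treeCost (ch v) o : ℝ)
    set Z := ∑ v, I.pot φ lam (I.child N t v)
    have h1 : L * I.P (N.filter fun o => (I.treeCost τ' o : ℝ) ≤ Y / L) ≤ s * Y := by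
      have := mul_le_mul_of_nonneg_left hrate hL.le
      have e : L * (s * (Y / L)) = s * Y := by field_simp
      linarith
    have h2 := mul_le_mul_of_nonneg_left h1 hw.le
    have h3 := mul_le_mul_of_nonneg_left hfin hL.le
    have h4 := mul_le_mul_of_nonneg_left hgain hY0
    have h5 := mul_le_mul_of_nonneg_left hpot hw.le
    have h6 : L * (w * I.P N) = w * (L * I.P (N.filter fun o => (I.treeCost τ' o : ℝ) ≤ Y / L)) +
        L * (w * I.P (N.filter fun o => ¬ (I.treeCost τ' o : ℝ) ≤ Y / L)) := by
      rw [hsplit]; ring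
    -- Raising the weight from `y` to `Y` costs `w * pot`, which is at most `potBound` times the
    -- expected cost of the current test.
    have h7 : Y * I.pot φ lam N = y * I.pot φ lam N + w * I.pot φ lam N := by rw [hY]; ring
    rw [mul_add L, mul_add (I.potBound φ lam), h6]
    linarith

/-! ### Existence and feasibility of greedy trees -/

omit [DecidableEq O] [Fintype C] in
-- Objects that no test distinguishes from `i` follow `i` into the same leaf.
theorem Feasible.separates {τ : DTree C T I.arity} (h : I.Feasible τ) : I.Separates := by
  intro i
  have key : ∀ (τ : DTree C T I.arity) (M : Finset O), I.FeasibleFrom M τ →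
      I.reach i (Finset.univ : Finset T) ⊆ M →
      I.pairs (I.reach i (Finset.univ : Finset T)) = 0 ∨
        I.P (I.reach i (Finset.univ : Finset T)) ≤ I.thr := by
    intro τ
    induction τ with
    | leaf c =>
      intro M hf hM
      exact Or.imp (fun h => Nat.le_zero.mp ((I.pairs_mono hM).trans_eq h)) (I.P_mono hM).trans hf
    | node t ch ih =>
      intro M hf hM
      refine ih (I.outcome t i) _ (hf _) fun o ho => I.mem_child.mpr ⟨hM ho, ?_⟩
      rw [reach, Finset.mem_filter] at ho
      exact ho.2 t (Finset.mem_univ t)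
  exact key τ Finset.univ h (Finset.subset_univ _)

omit [DecidableEq O] in
theorem GreedyFrom.feasibleFrom {N : Finset O} {S : Finset T}
    {τ : DTree C T I.arity} (h : I.GreedyFrom φ lam N S τ) : I.FeasibleFrom N τ := by
  induction h with
  | leaf N S c hdone hc => exact hdone.imp_left I.pairs_eq_zero_iff.mpr
  | split N S vmax t ch hdone hmax hnew hgreedy hrec ih => exact ih

omit [DecidableEq O] [Fintype T] [DecidableEq T] in
theorem exists_isMajority (N : Finset O) : ∃ c, I.IsMajority N c := by
  obtain ⟨o⟩ := I.nonempty_objects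
  have : Nonempty C := ⟨I.cls o⟩
  exact Finite.exists_max fun c => (N.filter fun o => I.cls o = c).card

omit [DecidableEq O] [Fintype C] [DecidableEq C] [Fintype T] [DecidableEq T] in
theorem exists_largest_child (N : Finset O) : ∃ vmax : (e : T) → Fin (I.arity e),
    ∀ e, ∀ v, (I.child N e v).card ≤ (I.child N e (vmax e)).card := by
  obtain ⟨o⟩ := I.nonempty_objects
  have h : ∀ e, ∃ v₀, ∀ v, (I.child N e v).card ≤ (I.child N e v₀).card := fun e => by
    have : Nonempty (Fin (I.arity e)) := ⟨I.outcome e o⟩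
    exact Finite.exists_max fun v => (I.child N e v).card
  choose vmax hmax using h
  exact ⟨vmax, hmax⟩

omit [DecidableEq O] in
-- Induction on the number of unused tests. When none is left, a nonempty `N` consists of
-- indistinguishable objects, and `Separates` makes it a leaf.
theorem exists_greedyFrom (hT : I.Separates) (φ : C → ℝ → ℝ) (lam : ℝ) (n : ℕ) :
    ∀ (N : Finset O) (S : Finset T), (Finset.univ \ S).card = n →
      (∀ i ∈ N, I.reach i S = N) → ∃ τ, I.GreedyFrom φ lam N S τ := by
  induction n with
  | zero =>
    intro N S hS hr
    obtain ⟨c, hc⟩ := I.exists_isMajority N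
    refine ⟨.leaf c, .leaf N S c ?_ hc⟩
    rcases N.eq_empty_or_nonempty with rfl | ⟨i, hi⟩
    · exact Or.inl (by simp [Homogeneous])
    · have hS' : S = Finset.univ := by
        rw [Finset.card_eq_zero, Finset.sdiff_eq_empty_iff_subset] at hS
        exact Finset.univ_subset_iff.mp hS
      have := hT i
      rw [← hS', hr i hi] at this
      exact this.imp_left I.pairs_eq_zero_iff.mp
  | succ n ih =>
    intro N S hS hr
    by_cases hdone : I.Homogeneous N ∨ I.P N ≤ I.thr
    · obtain ⟨c, hc⟩ := I.exists_isMajority N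
      exact ⟨.leaf c, .leaf N S c hdone hc⟩
    · obtain ⟨vmax, hmax⟩ := I.exists_largest_child N
      obtain ⟨t, ht, hgreedy⟩ := Finset.exists_max_image (Finset.univ \ S)
        (fun e => I.score φ lam N S e (vmax e)) (Finset.card_pos.mp (by omega))
      have htS : t ∉ S := (Finset.mem_sdiff.mp ht).2
      have hrec : ∀ v, ∃ τ, I.GreedyFrom φ lam (I.child N t v) (insert t S) τ := fun v =>
        ih _ _ (by
          rw [Finset.sdiff_insert, Finset.card_erase_of_mem ht, hS, Nat.add_sub_cancel])
          (I.reach_child hr t v)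
      choose ch hch using hrec
      exact ⟨.node t ch, .split N S vmax t ch hdone hmax htS
        (fun e he => hgreedy e (by simp [he])) hch⟩

/-! ### The approximation ratio -/

omit [DecidableEq O] [Fintype C] [DecidableEq C] [Fintype T] [DecidableEq T] in
theorem Unfinished.two_le_card (h : I.Unfinished Finset.univ) : 2 ≤ Fintype.card O := by
  by_contra! hc
  have : Subsingleton O := Fintype.card_le_one_iff_subsingleton.mp (by omega)
  exact h (Or.inl fun a _ b _ => by rw [Subsingleton.elim a b])

omit [DecidableEq O] [Fintype C] [DecidableEq C] [Fintype T] [DecidableEq T] in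
theorem log_one_div_pMin_nonneg : 0 ≤ Real.log (1 / I.pMin) :=
  Real.log_nonneg (by rw [le_div_iff₀ I.pMin_pos]; linarith [I.pMin_le_one])

omit [DecidableEq O] [Fintype T] [DecidableEq T] in
-- An unfinished root has `n ≥ 2`, hence `1 / pMin ≥ 2`, and the logarithms absorb the additive
-- constants. The coefficient of `log n` is at most `2 + 6 + 3`, where the 3 covers the constant 2;
-- that of `log (1 / pMin)` is 4.
theorem potBound_le (hφ : IsDecomposableImpurity φ) (hl : 0 ≤ lam)
    (h : I.Unfinished Finset.univ) :
    I.potBound φ lam ≤ 12 * (Real.log (1 / I.pMin) + Real.log (Fintype.card O : ℝ) +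
      lam * I.maxScore φ) := by
  have hn : (2 : ℝ) ≤ Fintype.card O := by exact_mod_cast h.two_le_card
  have hl2 := Real.log_two_gt_d9
  have hlog : Real.log 2 ≤ Real.log (Fintype.card O) := Real.log_le_log two_pos hn
  have hq := I.pMin_pos
  have h1 : Real.logb 2 (Fintype.card O) ≤ 2 * Real.log (Fintype.card O) := by
    rw [Real.logb, div_le_iff₀ (by linarith)]
    nlinarith
  have h2 : Real.log (1 + (Fintype.card O : ℝ) ^ 2) ≤ 3 * Real.log (Fintype.card O) := by
    have : Real.log ((Fintype.card O : ℝ) ^ 3) = 3 * Real.log (Fintype.card O) := by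
      rw [Real.log_pow]; norm_num
    rw [← this]
    refine Real.log_le_log (by positivity) ?_
    nlinarith [mul_nonneg (sub_nonneg.mpr hn) (sq_nonneg (Fintype.card O : ℝ))]
  have hq2 : 2 ≤ 1 / I.pMin := by
    have h3 : (Fintype.card O : ℝ) * I.pMin ≤ 1 := by
      rw [← I.prob_sum, ← nsmul_eq_mul]
      exact Finset.card_nsmul_le_sum _ _ _ fun o _ => I.pMin_le o
    rw [le_div_iff₀ hq]
    nlinarith
  have h3 : Real.log (1 + 1 / I.pMin) ≤ 2 * Real.log (1 / I.pMin) := by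
    have : Real.log ((1 / I.pMin) ^ 2) = 2 * Real.log (1 / I.pMin) := by
      rw [Real.log_pow]; norm_num
    rw [← this]
    refine Real.log_le_log (by positivity) ?_
    nlinarith
  have h4 := I.log_one_div_pMin_nonneg
  have h5 := mul_nonneg hl (I.maxScore_nonneg hφ)
  unfold potBound
  linarith

theorem IsGreedyTree.expectedCost_le (hφ : IsDecomposableImpurity φ) (hl : 0 ≤ lam)
    {τ τ' : DTree C T I.arity} (h : I.IsGreedyTree φ lam τ) (hf : I.Feasible τ') :
    I.expectedCost τ ≤ 48 * (Real.log (1 / I.pMin) + Real.log (Fintype.card O : ℝ) +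
      lam * I.maxScore φ) * I.expectedCost τ' := by
  have hopt : 0 ≤ I.expectedCost τ' :=
    Finset.sum_nonneg fun o _ => mul_nonneg (I.prob_pos o).le (Nat.cast_nonneg _)
  have h4 := I.log_one_div_pMin_nonneg
  have h5 := mul_nonneg hl (I.maxScore_nonneg hφ)
  have h6 : 0 ≤ Real.log (Fintype.card O : ℝ) := Real.log_natCast_nonneg _
  by_cases h0 : I.Unfinished Finset.univ
  · have hB := I.potBound_le hφ hl h0
    have hC : 0 < I.potBound φ lam := by
      have hn : (1 : ℝ) < Fintype.card O := by exact_mod_cast h0.two_le_card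
      have h7 := Real.logb_pos one_lt_two hn
      have h8 := Real.log_nonneg (show (1 : ℝ) ≤ 1 + 1 / I.pMin by
        have := I.pMin_pos
        have : 0 ≤ 1 / I.pMin := by positivity
        linarith)
      have h9 := Real.log_nonneg (show (1 : ℝ) ≤ 1 + (Fintype.card O : ℝ) ^ 2 by nlinarith)
      unfold potBound
      linarith
    -- At `y = 0` the potential term vanishes, and with this `L` half of the left side survives the
    -- absorption.
    have hmain := GreedyFrom.cost_le I (Feasible.separates I hf) hφ hl hf (L := 2 * I.potBound φ lam)
      (by linarith) h (by intro i _; simp [reach]) 0 le_rfl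
    have e : ∑ o, I.prob o * max (2 * I.potBound φ lam * I.treeCost τ' o - 0) 0 =
        2 * I.potBound φ lam * I.expectedCost τ' := by
      rw [expectedCost, Finset.mul_sum]
      refine Finset.sum_congr rfl fun o _ => ?_
      rw [sub_zero, max_eq_left (by positivity)]
      ring
    rw [e] at hmain
    change 2 * I.potBound φ lam * I.expectedCost τ ≤ 0 * _ +
      I.potBound φ lam * I.expectedCost τ + _ at hmain
    have h10 : I.expectedCost τ ≤ 4 * I.potBound φ lam * I.expectedCost τ' := by
      refine le_of_mul_le_mul_left ?_ hC
      linarith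
    refine h10.trans (mul_le_mul_of_nonneg_right ?_ hopt)
    linarith
  · have hz : I.expectedCost τ = 0 := by
      cases h with
      | leaf => simp [expectedCost, treeCost]
      | split => exact absurd ‹_› h0
    rw [hz]
    positivity

end

end NGI

theorem theorem1 :
    ∃ K : ℝ, 0 < K ∧
      ∀ (O C T : Type) [Fintype O] [DecidableEq O] [Fintype C] [DecidableEq C]
        [Fintype T] [DecidableEq T] (I : NGI O C T)
        (φ : C → ℝ → ℝ), IsDecomposableImpurity φ → ∀ lam : ℝ, 0 ≤ lam →
        (∃ τ, I.Feasible τ) →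
        (∃ τ, I.IsGreedyTree φ lam τ) ∧
        ∀ τ, I.IsGreedyTree φ lam τ →
          I.Feasible τ ∧
          ∀ τ', I.Feasible τ' →
            I.expectedCost τ ≤
              K * (Real.log (1 / I.pMin) + Real.log (Fintype.card O : ℝ)
                + lam * I.maxScore φ) * I.expectedCost τ' := by
  refine ⟨48, by norm_num, ?_⟩
  intro O C T _ _ _ _ _ _ I φ hφ lam hl hfeas
  obtain ⟨τ₀, hτ₀⟩ := hfeas
  refine ⟨I.exists_greedyFrom (NGI.Feasible.separates I hτ₀) φ lam _ Finset.univ ∅ rfl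
    (by intro i _; simp [NGI.reach]), fun τ hτ => ⟨NGI.GreedyFrom.feasibleFrom I hτ, ?_⟩⟩
  exact fun τ' hτ' => NGI.IsGreedyTree.expectedCost_le I hφ hl hτ hτ'
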